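/- Let $\mathcal X$ be a Polish space with its Borel $\sigma$-field, and let $d$ be a metric on $\mathcal X$ that is lower semicontinuous on $\mathcal X\times\mathcal X$ (for example, a metric inducing the topology of $\mathcal X$; in general $d$ need not induce it). Let $\theta:[0,\infty)\to[0,\infty)$ be a convex function with $\theta(0)=0$, let $c(x,y)=\theta(d(x,y))$, and let $\mu$ be a Borel probability measure on $\mathcal X$. Suppose that $\mu$ satisfies the transport-entropy inequality $\mathcal T_c\le H$, that is, $$\inf_{\pi}\int_{\mathcal X\times\mathcal X} c(x,y)\,d\pi(x,y)\ \le\ H(\nu|\mu)\qquad\text{for every Borel probability measure }\nu\text{ on }\mathcal X,$$ where the infimum runs over all probability measures $\pi$ on $\mathcal X\times\mathcal X$ with first marginal $\nu$ and second marginal $\mu$, and $H(\nu|\mu)=\int\log\frac{d\nu}{d\mu}\,d\nu$ if $\nu\ll\mu$, $H(\nu|\mu)=+\infty$ otherwise. Then the couple $(\mu,\tilde c)$ with $\tilde c(x,y)=2\,\theta\!\left(\frac{d(x,y)}{2}\right)$ satisfies Property $(\tau)$: for every bounded Borel function $f:\mathcal X\to\mathbb R$, the function $Q_{\tilde c}f(x)=\inf_{y\in\mathcal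 X}\{f(y)+\tilde c(x,y)\}$ is measurable with respect to the $\mu$-completion of the Borel $\sigma$-field, and $$\left(\int e^{Q_{\tilde c}f}\,d\mu\right)\left(\int e^{-f}\,d\mu\right)\le 1.$$ -/

import Mathlib

open MeasureTheory Set
open scoped ENNReal

namespace TransportTau

/-- `d` is a metric (distance function) on the set `X`. Nonnegativity follows from the axioms.
The metric need not induce a topology that `X` may already carry. -/
structure IsMetric {X : Type*} (d : X → X → ℝ) : Prop where
  eq_zero_iff : ∀ x y, d x y = 0 ↔ x = y
  symm : ∀ x y, d x y = d y x
  triangle : ∀ x y z, d x z ≤ d x y + d y z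

/-- `π` is a coupling of `ν` and `μ`: its first marginal is `ν` and its second marginal is `μ`. -/
def IsCoupling {X : Type*} [MeasurableSpace X] (π : Measure (X × X)) (ν μ : Measure X) : Prop :=
  π.map Prod.fst = ν ∧ π.map Prod.snd = μ

/-- The optimal transport cost `𝒯_c(ν, μ) = inf_π ∫ c dπ ∈ [0, ∞]`, for a nonnegative cost `c`,
the infimum being over all couplings `π` of `ν` and `μ`. -/
noncomputable def transportCost {X : Type*} [MeasurableSpace X] (c : X → X → ℝ)
    (ν μ : Measure X) : ℝ≥0∞ :=
  ⨅ (π : Measure (X × X)) (_ : IsCoupling π ν μ), ∫⁻ p, ENNReal.ofReal (c p.1 p.2) ∂π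

/-- The transport-entropy inequality `𝒯_c ≤ H`: one has `𝒯_c(ν, μ) ≤ H(ν|μ)` for every probability
measure `ν`. For probability measures, `InformationTheory.klDiv ν μ` is the relative entropy
`H(ν|μ) = ∫ log (dν/dμ) dν` if `ν ≪ μ` and `∞` otherwise. -/
def TransportEntropyInequality {X : Type*} [MeasurableSpace X] (c : X → X → ℝ)
    (μ : Measure X) : Prop :=
  ∀ ν : Measure X, IsProbabilityMeasure ν → transportCost c ν μ ≤ InformationTheory.klDiv ν μ

/-- The inf-convolution `Q_c f (x) = inf_y {f y + c x y}`. -/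
noncomputable def infConv {X : Type*} (c : X → X → ℝ) (f : X → ℝ) (x : X) : ℝ :=
  ⨅ y, (f y + c x y)

/-- Property (τ) for the couple `(μ, c)`: for each bounded Borel function `f`,
`(∫ exp (Q_c f) dμ) * (∫ exp (-f) dμ) ≤ 1`. As `Q_c f` need not be a Borel function, that the
first integral makes sense (`Q_c f` is measurable for the completion of `μ`) is stated too. -/
def PropertyTau {X : Type*} [MeasurableSpace X] (μ : Measure X) (c : X → X → ℝ) : Prop :=
  ∀ f : X → ℝ, Measurable f → (∃ M : ℝ, ∀ x, |f x| ≤ M) →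
    AEMeasurable (infConv c f) μ ∧
    (∫⁻ x, ENNReal.ofReal (Real.exp (infConv c f x)) ∂μ) *
      (∫⁻ x, ENNReal.ofReal (Real.exp (-f x)) ∂μ) ≤ 1

end TransportTau

/-!
The transport-entropy inequality has a dual form, obtained by testing it on the measure with density
proportional to `exp u` and bounding the transport cost from below by Kantorovich duality: if
`u x - v z ≤ c x z` for all `x` and `z`, then `∫ exp u dμ ≤ exp (∫ v dμ)`. Put
`c' x y = 2 θ(d(x, y) / 2)` and `v z = inf_y {f y + c y z}`. Convexity of `θ` and the triangle
inequality give `c' x y ≤ c x z + c y z`, so the pairs `(Q_{c'} f, v)` and `(-f, -v)` are both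
admissible, and the product of the two resulting bounds is `exp (∫ v dμ) exp (-∫ v dμ) = 1`.

The sublevel sets of an inf-convolution are projections of Borel sets, hence analytic, so its
measurability is Lusin's theorem that analytic sets are universally measurable.
-/

namespace TransportTau

open InformationTheory

section AnalyticSet

theorem exists_cylinder_subset_of_isCompact {E : ℕ → Type*} [∀ n, TopologicalSpace (E n)]
    [∀ n, DiscreteTopology (E n)] {K V : Set (∀ n, E n)} (hK : IsCompact K) (hV : IsOpen V)
    (hKV : K ⊆ V) : ∃ n, ∀ x ∈ K, PiNat.cylinder x n ⊆ V := by
  refine hK.induction_on (p := fun s => ∃ n, ∀ x ∈ s, PiNat.cylinder x n ⊆ V)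
    ⟨0, fun _ hx => absurd hx (notMem_empty _)⟩
    (fun s t hst ⟨n, hn⟩ => ⟨n, fun x hx => hn x (hst hx)⟩) ?_ fun x hx => ?_
  · rintro s t ⟨m, hm⟩ ⟨n, hn⟩
    refine ⟨max m n, fun x hx => ?_⟩
    rcases hx with hxs | hxt
    · exact (PiNat.cylinder_anti x (le_max_left m n)).trans (hm x hxs)
    · exact (PiNat.cylinder_anti x (le_max_right m n)).trans (hn x hxt)
  · obtain ⟨_, ⟨y, n, rfl⟩, hxy, hyV⟩ :=
      (PiNat.isTopologicalBasis_cylinders E).exists_subset_of_mem_open (hKV hx) hV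
    refine ⟨PiNat.cylinder y n, mem_nhdsWithin_of_mem_nhds
      ((PiNat.isOpen_cylinder E y n).mem_nhds hxy), n, fun z hz => ?_⟩
    rwa [PiNat.mem_cylinder_iff_eq.1 hz]

theorem isCompact_Iic_of_orderBot {α : Type*} [TopologicalSpace α] [Preorder α] [OrderBot α]
    [CompactIccSpace α] (a : α) : IsCompact (Iic a) :=
  Icc_bot (a := a) ▸ isCompact_Icc

theorem exists_pi_Iio_Iic_subset_of_isOpen {k : ℕ → ℕ} {V : Set (ℕ → ℕ)} (hV : IsOpen V)
    (hkV : Iic k ⊆ V) : ∃ n, (Iio n).pi (fun i => Iic (k i)) ⊆ V := by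
  obtain ⟨n, hn⟩ := exists_cylinder_subset_of_isCompact (isCompact_Iic_of_orderBot k) hV hkV
  -- `x` and its truncation `x ⊓ k` have the same first `n` coordinates.
  refine ⟨n, fun x hx => hn (x ⊓ k) (mem_Iic.2 inf_le_right) ?_⟩
  exact PiNat.mem_cylinder_iff.2 fun i hi => (min_eq_left (hx i hi)).symm

theorem exists_lt_measure_image_inter_Iic {α β : Type*} [MeasurableSpace β] (μ : Measure β)
    (f : α → β) (g : α → ℕ) {s : Set α} {a : ℝ≥0∞} (ha : a < μ (f '' s)) :
    ∃ m, a < μ (f '' (s ∩ g ⁻¹' Iic m)) := by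
  have hmono : Monotone fun m => f '' (s ∩ g ⁻¹' Iic m) := fun _ _ h =>
    image_mono (inter_subset_inter_right _ (preimage_mono (Iic_subset_Iic.2 h)))
  have hunion : ⋃ m, f '' (s ∩ g ⁻¹' Iic m) = f '' s := by
    rw [← image_iUnion, ← inter_iUnion, ← preimage_iUnion, iUnion_Iic, preimage_univ, inter_univ]
  rw [← hunion, hmono.measure_iUnion] at ha
  exact lt_iSup_iff.1 ha

theorem exists_forall_lt_measure_image_pi_Iio {β : Type*} [MeasurableSpace β] (μ : Measure β)
    (f : (ℕ → ℕ) → β) {a : ℝ≥0∞} (ha : a < μ (range f)) :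
    ∃ k : ℕ → ℕ, ∀ n, a < μ (f '' (Iio n).pi fun i => Iic (k i)) := by
  choose m hm using fun (n : ℕ) (s : {s : Set (ℕ → ℕ) // a < μ (f '' s)}) =>
    exists_lt_measure_image_inter_Iic μ f (fun x => x n) s.2
  let T : ℕ → {s : Set (ℕ → ℕ) // a < μ (f '' s)} := fun n =>
    Nat.rec ⟨univ, by rwa [image_univ]⟩ (fun n s => ⟨_, hm n s⟩) n
  have hT : ∀ n, (T n).1 ⊆ (Iio n).pi fun i => Iic (m i (T i)) := by
    intro n
    induction n with
    | zero => exact fun x _ i hi => absurd hi (Nat.not_lt_zero i)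
    | succ n ih =>
      rintro x ⟨hx, hxn⟩ i hi
      rcases Nat.lt_succ_iff_lt_or_eq.1 hi with h | rfl
      · exact ih hx i h
      · exact hxn
  exact ⟨fun i => m i (T i), fun n => (T n).2.trans_le (measure_mono (image_mono (hT n)))⟩

variable {X : Type*} [TopologicalSpace X] [T2Space X] {f : (ℕ → ℕ) → X}

theorem iInter_closure_image_pi_Iio_subset (hf : Continuous f) (k : ℕ → ℕ) :
    ⋂ n, closure (f '' (Iio n).pi fun i => Iic (k i)) ⊆ f '' Iic k := by
  intro y hy
  by_contra hyk
  obtain ⟨V, W, hV, hW, hkV, hyW, hVW⟩ :=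
    ((isCompact_Iic_of_orderBot k).image hf).separation_of_notMem hyk
  obtain ⟨n, hn⟩ := exists_pi_Iio_Iic_subset_of_isOpen (hV.preimage hf) (image_subset_iff.1 hkV)
  obtain ⟨z, hzW, hz⟩ := mem_closure_iff.1 (mem_iInter.1 hy n) W hW hyW
  exact disjoint_left.1 hVW (image_subset_iff.2 hn hz) hzW

theorem exists_isCompact_subset_range_le_measure [MeasurableSpace X] [OpensMeasurableSpace X]
    (μ : Measure X) [IsFiniteMeasure μ] (hf : Continuous f) {a : ℝ≥0∞} (ha : a < μ (range f)) :
    ∃ K ⊆ range f, IsCompact K ∧ a ≤ μ K := by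
  obtain ⟨k, hk⟩ := exists_forall_lt_measure_image_pi_Iio μ f ha
  have hanti : Antitone fun n => closure (f '' (Iio n).pi fun i => Iic (k i)) := fun _ _ h =>
    closure_mono (image_mono (pi_mono' (fun _ _ => le_rfl) (Iio_subset_Iio h)))
  refine ⟨f '' Iic k, image_subset_range _ _, (isCompact_Iic_of_orderBot k).image hf, ?_⟩
  calc a ≤ ⨅ n, μ (closure (f '' (Iio n).pi fun i => Iic (k i))) :=
        le_iInf fun n => (hk n).le.trans (measure_mono subset_closure)
    _ = μ (⋂ n, closure (f '' (Iio n).pi fun i => Iic (k i))) :=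
        (hanti.measure_iInter (fun _ => isClosed_closure.nullMeasurableSet)
          ⟨0, measure_ne_top _ _⟩).symm
    _ ≤ μ (f '' Iic k) := measure_mono (iInter_closure_image_pi_Iio_subset hf k)

theorem nullMeasurableSet_range_of_continuous [MeasurableSpace X] [OpensMeasurableSpace X]
    (μ : Measure X) [IsFiniteMeasure μ] (hf : Continuous f) : NullMeasurableSet (range f) μ := by
  rcases eq_or_ne (μ (range f)) 0 with hnull | hpos
  · exact .of_null hnull
  obtain ⟨a, -, ha, hlim⟩ := exists_seq_strictMono_tendsto' (pos_iff_ne_zero.2 hpos)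
  choose K hK_sub hK hK_le using fun n =>
    exists_isCompact_subset_range_le_measure μ hf (ha n).2
  have hU : NullMeasurableSet (⋃ n, K n) μ :=
    .iUnion fun n => (hK n).measurableSet.nullMeasurableSet
  refine hU.congr (ae_eq_of_subset_of_measure_ge (iUnion_subset hK_sub) ?_ hU (measure_ne_top _ _))
  exact le_of_tendsto' hlim fun n => (hK_le n).trans (measure_mono (subset_iUnion K n))

theorem nullMeasurableSet_of_analyticSet [MeasurableSpace X] [OpensMeasurableSpace X]
    (μ : Measure X) [SFinite μ] {s : Set X} (hs : AnalyticSet s) : NullMeasurableSet s μ := by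
  obtain ⟨ν, hν, hμν, -⟩ := exists_isFiniteMeasure_absolutelyContinuous μ
  rw [AnalyticSet] at hs
  rcases hs with rfl | ⟨f, hf, rfl⟩
  · exact nullMeasurableSet_empty
  · exact (nullMeasurableSet_range_of_continuous ν hf).mono_ac hμν

theorem nullMeasurableSet_image {Y Z : Type*} [MeasurableSpace Y] [StandardBorelSpace Y]
    [MeasurableSpace Z] [MeasurableSpace.CountablySeparated Z] (μ : Measure Z) [SFinite μ]
    {g : Y → Z} (hg : Measurable g) {s : Set Y} (hs : MeasurableSet s) :
    NullMeasurableSet (g '' s) μ := by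
  obtain ⟨_, _, _, _⟩ := exists_opensMeasurableSpace_of_countablySeparated Z
  exact nullMeasurableSet_of_analyticSet μ (hs.analyticSet_image hg)

end AnalyticSet

section InfConv

variable {X : Type*} {c : X → X → ℝ} {f : X → ℝ}

theorem bddBelow_range_add (hc : ∀ x y, 0 ≤ c x y) (hf : BddBelow (range f)) (x : X) :
    BddBelow (range fun y => f y + c x y) :=
  hf.range_mono _ fun y => le_add_of_nonneg_right (hc x y)

theorem infConv_le (hc : ∀ x y, 0 ≤ c x y) (hf : BddBelow (range f)) (x y : X) :
    infConv c f x ≤ f y + c x y :=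
  ciInf_le (bddBelow_range_add hc hf x) y

theorem abs_infConv_le (hc : ∀ x y, 0 ≤ c x y) (hc_self : ∀ x, c x x = 0) {M : ℝ}
    (hf : ∀ x, |f x| ≤ M) (x : X) : |infConv c f x| ≤ M := by
  have : Nonempty X := ⟨x⟩
  have hf_bdd : BddBelow (range f) := ⟨-M, forall_mem_range.2 fun y => (abs_le.1 (hf y)).1⟩
  refine abs_le.2 ⟨le_ciInf fun y => ?_, ?_⟩
  · exact (abs_le.1 (hf y)).1.trans (le_add_of_nonneg_right (hc x y))
  · calc infConv c f x ≤ f x + c x x := infConv_le hc hf_bdd x x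
      _ = f x := by rw [hc_self, add_zero]
      _ ≤ M := (abs_le.1 (hf x)).2

theorem infConv_sub_infConv_flip_le {c' : X → X → ℝ} (hc' : ∀ x y, 0 ≤ c' x y)
    (hcc' : ∀ x y z, c' x y ≤ c x z + c y z) (hf : BddBelow (range f)) (x z : X) :
    infConv c' f x - infConv (flip c) f z ≤ c x z := by
  have : Nonempty X := ⟨x⟩
  rw [sub_le_comm]
  refine le_ciInf fun y => ?_
  have hQ := infConv_le hc' hf x y
  have hxyz := hcc' x y z
  rw [flip]
  linarith

theorem aemeasurable_of_nullMeasurableSet_Iio {Y Z : Type*} [MeasurableSpace Y] {μ : Measure Y}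
    [TopologicalSpace Z] [LinearOrder Z] [OrderTopology Z] [SecondCountableTopology Z]
    [MeasurableSpace Z] [BorelSpace Z] {g : Y → Z}
    (hg : ∀ t, NullMeasurableSet (g ⁻¹' Iio t) μ) : AEMeasurable g μ :=
  have hg' : @Measurable (NullMeasurableSpace Y μ) Z _ _ g := measurable_of_Iio hg
  NullMeasurable.aemeasurable fun _ hs => hg' hs

theorem aemeasurable_infConv [MeasurableSpace X] [StandardBorelSpace X] (μ : Measure X)
    [SFinite μ] (hc_meas : Measurable fun p : X × X => c p.1 p.2) (hc : ∀ x y, 0 ≤ c x y)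
    (hf_meas : Measurable f) (hf : BddBelow (range f)) : AEMeasurable (infConv c f) μ := by
  refine aemeasurable_of_nullMeasurableSet_Iio fun t => ?_
  have hproj : infConv c f ⁻¹' Iio t = Prod.fst '' {p : X × X | f p.2 + c p.1 p.2 < t} := by
    ext x
    have : Nonempty X := ⟨x⟩
    simp only [mem_preimage, mem_Iio, infConv, ciInf_lt_iff (bddBelow_range_add hc hf x),
      mem_image, mem_ofPred_eq, Prod.exists, exists_and_right, exists_eq_right]
  rw [hproj]
  exact nullMeasurableSet_image μ measurable_fst
    (measurableSet_lt ((hf_meas.comp measurable_snd).add hc_meas) measurable_const)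

end InfConv

section Duality

variable {X : Type*} [MeasurableSpace X] {μ : Measure X}

theorem llr_tilted_self_ae_eq [SigmaFinite μ] {g : X → ℝ} (hg : AEMeasurable g μ)
    (hexp : Integrable (fun x => Real.exp (g x)) μ) :
    llr (μ.tilted g) μ =ᵐ[μ.tilted g] fun x => g x - Real.log (∫ x, Real.exp (g x) ∂μ) := by
  refine (tilted_absolutelyContinuous μ g).ae_eq ?_
  filter_upwards [llr_tilted_left .rfl hexp hg, llr_self μ] with x htilted hself
  rw [htilted, hself, Pi.zero_apply, add_zero]

theorem klDiv_tilted_self_ne_top [SigmaFinite μ] {g : X → ℝ} (hg : AEMeasurable g μ)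
    (hexp : Integrable (fun x => Real.exp (g x)) μ) (hg_tilted : Integrable g (μ.tilted g)) :
    klDiv (μ.tilted g) μ ≠ ∞ :=
  klDiv_ne_top (tilted_absolutelyContinuous μ g)
    ((integrable_congr (llr_tilted_self_ae_eq hg hexp)).2 (hg_tilted.sub (integrable_const _)))

theorem toReal_klDiv_tilted_self [IsProbabilityMeasure μ] {g : X → ℝ} (hg : AEMeasurable g μ)
    (hexp : Integrable (fun x => Real.exp (g x)) μ) (hg_tilted : Integrable g (μ.tilted g)) :
    (klDiv (μ.tilted g) μ).toReal =
      ∫ x, g x ∂(μ.tilted g) - Real.log (∫ x, Real.exp (g x) ∂μ) := by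
  have _ : IsProbabilityMeasure (μ.tilted g) := isProbabilityMeasure_tilted hexp
  rw [toReal_klDiv_of_measure_eq (tilted_absolutelyContinuous μ g)
      (by rw [measure_univ, measure_univ]),
    integral_congr_ae (llr_tilted_self_ae_eq hg hexp), integral_sub hg_tilted (integrable_const _),
    integral_const, probReal_univ, one_smul]

theorem ofReal_integral_le_lintegral_ofReal (μ : Measure X) (g : X → ℝ) :
    ENNReal.ofReal (∫ x, g x ∂μ) ≤ ∫⁻ x, ENNReal.ofReal (g x) ∂μ := by
  by_cases hg : Integrable g μ
  · rw [integral_eq_lintegral_pos_part_sub_lintegral_neg_part hg]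
    exact (ENNReal.ofReal_le_ofReal (sub_le_self _ ENNReal.toReal_nonneg)).trans
      ENNReal.ofReal_toReal_le
  · simp only [integral_undef hg, ENNReal.ofReal_zero, zero_le]

theorem ofReal_integral_sub_le_transportCost {ν : Measure X} {c : X → X → ℝ} {u v : X → ℝ}
    (hu : Integrable u ν) (hv : Integrable v μ) (huv : ∀ x z, u x - v z ≤ c x z) :
    ENNReal.ofReal (∫ x, u x ∂ν - ∫ z, v z ∂μ) ≤ transportCost c ν μ := by
  refine le_iInf₂ fun π hπ => ?_
  obtain ⟨rfl, rfl⟩ := hπ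
  have hsub : ∫ x, u x ∂(π.map Prod.fst) - ∫ z, v z ∂(π.map Prod.snd) =
      ∫ p, (u p.1 - v p.2) ∂π := by
    rw [integral_map measurable_fst.aemeasurable hu.1,
      integral_map measurable_snd.aemeasurable hv.1]
    exact (integral_sub (hu.comp_measurable measurable_fst)
      (hv.comp_measurable measurable_snd)).symm
  rw [hsub]
  exact (ofReal_integral_le_lintegral_ofReal π _).trans
    (lintegral_mono fun p => ENNReal.ofReal_le_ofReal (huv p.1 p.2))

namespace TransportEntropyInequality

variable [IsProbabilityMeasure μ] {c : X → X → ℝ}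

theorem integral_exp_le {u v : X → ℝ} (hμ : TransportEntropyInequality c μ)
    (hu : AEMeasurable u μ) (hexp : Integrable (fun x => Real.exp (u x)) μ)
    (hu_tilted : Integrable u (μ.tilted u)) (hv : Integrable v μ)
    (huv : ∀ x z, u x - v z ≤ c x z) : ∫ x, Real.exp (u x) ∂μ ≤ Real.exp (∫ z, v z ∂μ) := by
  have hduality := (ofReal_integral_sub_le_transportCost hu_tilted hv huv).trans
    (hμ _ (isProbabilityMeasure_tilted hexp))
  rw [ENNReal.ofReal_le_iff_le_toReal (klDiv_tilted_self_ne_top hu hexp hu_tilted),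
    toReal_klDiv_tilted_self hu hexp hu_tilted, sub_le_sub_iff_left] at hduality
  exact (Real.log_le_iff_le_exp (integral_exp_pos hexp)).1 hduality

theorem lintegral_exp_le_of_bounded {u v : X → ℝ} (hμ : TransportEntropyInequality c μ)
    (hu_meas : AEMeasurable u μ) {M : ℝ} (hu : ∀ x, |u x| ≤ M) (hv : Integrable v μ)
    (huv : ∀ x z, u x - v z ≤ c x z) :
    ∫⁻ x, ENNReal.ofReal (Real.exp (u x)) ∂μ ≤ ENNReal.ofReal (Real.exp (∫ z, v z ∂μ)) := by
  have hexp : Integrable (fun x => Real.exp (u x)) μ :=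
    .of_mem_Icc 0 (Real.exp M) hu_meas.exp <| ae_of_all _ fun x =>
      ⟨(Real.exp_pos _).le, Real.exp_le_exp.2 (le_of_abs_le (hu x))⟩
  have _ : IsProbabilityMeasure (μ.tilted u) := isProbabilityMeasure_tilted hexp
  have hu_tilted : Integrable u (μ.tilted u) :=
    .of_bound (hu_meas.mono_ac (tilted_absolutelyContinuous μ u)).aestronglyMeasurable M
      (ae_of_all _ hu)
  rw [← ofReal_integral_eq_lintegral_ofReal hexp (ae_of_all _ fun x => (Real.exp_pos _).le)]
  exact ENNReal.ofReal_le_ofReal (hμ.integral_exp_le hu_meas hexp hu_tilted hv huv)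

theorem propertyTau [StandardBorelSpace X] {c' : X → X → ℝ} (hμ : TransportEntropyInequality c μ)
    (hc_meas : Measurable fun p : X × X => c p.1 p.2) (hc : ∀ x y, 0 ≤ c x y)
    (hc_self : ∀ x, c x x = 0) (hc'_meas : Measurable fun p : X × X => c' p.1 p.2)
    (hc' : ∀ x y, 0 ≤ c' x y) (hcc' : ∀ x y z, c' x y ≤ c x z + c y z) : PropertyTau μ c' := by
  intro f hf_meas ⟨M, hf⟩
  have hf_bdd : BddBelow (range f) := ⟨-M, forall_mem_range.2 fun y => (abs_le.1 (hf y)).1⟩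
  have hc'_self (x : X) : c' x x = 0 :=
    le_antisymm (by simpa only [hc_self, add_zero] using hcc' x x x) (hc' x x)
  have hQ : AEMeasurable (infConv c' f) μ := aemeasurable_infConv μ hc'_meas hc' hf_meas hf_bdd
  have hc_flip : ∀ x y, 0 ≤ flip c x y := fun x y => hc y x
  have hc_flip_meas : Measurable fun p : X × X => flip c p.1 p.2 := hc_meas.comp measurable_swap
  set v := infConv (flip c) f
  have hv : Integrable v μ :=
    .of_bound (aemeasurable_infConv μ hc_flip_meas hc_flip hf_meas hf_bdd).aestronglyMeasurable M
      (ae_of_all _ (abs_infConv_le hc_flip hc_self hf))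
  have hQ_exp : ∫⁻ x, ENNReal.ofReal (Real.exp (infConv c' f x)) ∂μ ≤
      ENNReal.ofReal (Real.exp (∫ z, v z ∂μ)) :=
    hμ.lintegral_exp_le_of_bounded hQ (abs_infConv_le hc' hc'_self hf) hv
      (infConv_sub_infConv_flip_le hc' hcc' hf_bdd)
  have hneg_exp : ∫⁻ x, ENNReal.ofReal (Real.exp (-f x)) ∂μ ≤
      ENNReal.ofReal (Real.exp (∫ z, -v z ∂μ)) :=
    hμ.lintegral_exp_le_of_bounded hf_meas.neg.aemeasurable
      (fun x => (abs_neg (f x)).trans_le (hf x)) hv.neg fun x z => by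
        have hvz : v z ≤ f x + c x z := infConv_le hc_flip hf_bdd z x
        linarith
  refine ⟨hQ, (mul_le_mul' hQ_exp hneg_exp).trans_eq ?_⟩
  rw [integral_neg, ← ENNReal.ofReal_mul (Real.exp_pos _).le, ← Real.exp_add, add_neg_cancel,
    Real.exp_zero, ENNReal.ofReal_one]

end TransportEntropyInequality

end Duality

section ConvexCost

variable {θ : ℝ → ℝ} {a : ℝ}

theorem monotoneOn_Ici_of_convexOn_of_isMinOn (hθ : ConvexOn ℝ (Ici a) θ)
    (hmin : IsMinOn θ (Ici a) a) : MonotoneOn θ (Ici a) := by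
  intro s hs t ht hst
  rcases (mem_Ici.1 hs).eq_or_lt with rfl | has
  · exact hmin ht
  · exact hθ.le_right_of_left_le'' self_mem_Ici ht has hst (hmin hs)

theorem measurable_comp_of_monotoneOn_Ici {Y : Type*} [MeasurableSpace Y]
    (hθ : MonotoneOn θ (Ici a)) {g : Y → ℝ} (hg : Measurable g) (hg_le : ∀ y, a ≤ g y) :
    Measurable fun y => θ (g y) := by
  have hmono : Monotone fun t => θ (max t a) := fun s t hst =>
    hθ (le_max_right s a) (le_max_right t a) (max_le_max_right a hst)
  simpa only [Function.comp_def, max_eq_left (hg_le _)] using hmono.measurable.comp hg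

theorem two_mul_half_le_add (hθ : ConvexOn ℝ (Ici 0) θ) (hmono : MonotoneOn θ (Ici 0))
    {r s t : ℝ} (hr : 0 ≤ r) (hs : 0 ≤ s) (ht : 0 ≤ t) (hrst : r ≤ s + t) :
    2 * θ (r / 2) ≤ θ s + θ t := by
  have hmidpoint : θ ((s + t) / 2) ≤ (θ s + θ t) / 2 := by
    have h := hθ.2 hs ht one_half_pos.le one_half_pos.le (add_halves 1)
    calc θ ((s + t) / 2) = θ (1 / 2 * s + 1 / 2 * t) := by ring_nf
      _ ≤ 1 / 2 * θ s + 1 / 2 * θ t := h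
      _ = (θ s + θ t) / 2 := by ring
  have hr_le : θ (r / 2) ≤ θ ((s + t) / 2) :=
    hmono (mem_Ici.2 (by positivity)) (mem_Ici.2 (by positivity)) (by linarith)
  linarith

end ConvexCost

end TransportTau

theorem mainTheorem8_general {X : Type*} [MeasurableSpace X] [StandardBorelSpace X]
    (d : X → X → ℝ) (hd_self : ∀ x, d x x = 0) (hd_symm : ∀ x y, d x y = d y x)
    (hd_triangle : ∀ x y z, d x z ≤ d x y + d y z)
    (hd_meas : Measurable fun p : X × X => d p.1 p.2)
    (μ : Measure X) [IsProbabilityMeasure μ]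
    (θ : ℝ → ℝ) (hθ_convex : ConvexOn ℝ (Ici 0) θ) (hθ_nonneg : ∀ t, 0 ≤ t → 0 ≤ θ t)
    (hθ_zero : θ 0 = 0)
    (hμ : TransportTau.TransportEntropyInequality (fun x y => θ (d x y)) μ) :
    TransportTau.PropertyTau μ (fun x y => 2 * θ (d x y / 2)) := by
  have hd_nonneg (x y : X) : 0 ≤ d x y := by
    linarith [hd_self x, hd_triangle x y x, hd_symm x y]
  have hd_half (x y : X) : 0 ≤ d x y / 2 := div_nonneg (hd_nonneg x y) zero_le_two
  have hθ_mono : MonotoneOn θ (Ici 0) :=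
    TransportTau.monotoneOn_Ici_of_convexOn_of_isMinOn hθ_convex fun t ht =>
      hθ_zero.trans_le (hθ_nonneg t ht)
  refine hμ.propertyTau
    (TransportTau.measurable_comp_of_monotoneOn_Ici hθ_mono hd_meas fun p => hd_nonneg p.1 p.2)
    (fun x y => hθ_nonneg _ (hd_nonneg x y))
    (fun x => by rw [hd_self, hθ_zero])
    ((TransportTau.measurable_comp_of_monotoneOn_Ici hθ_mono (hd_meas.div_const 2)
      fun p => hd_half p.1 p.2).const_mul 2)
    (fun x y => mul_nonneg zero_le_two (hθ_nonneg _ (hd_half x y)))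
    fun x y z => TransportTau.two_mul_half_le_add hθ_convex hθ_mono (hd_nonneg x y)
      (hd_nonneg x z) (hd_nonneg y z) ?_
  rw [hd_symm y z]
  exact hd_triangle x z y

theorem mainTheorem8 {X : Type*} [TopologicalSpace X] [PolishSpace X]
    [MeasurableSpace X] [BorelSpace X]
    (d : X → X → ℝ) (hd : TransportTau.IsMetric d)
    (hd_lsc : LowerSemicontinuous (fun p : X × X => d p.1 p.2))
    (μ : Measure X) [IsProbabilityMeasure μ]
    (θ : ℝ → ℝ) (hθ_convex : ConvexOn ℝ (Ici 0) θ) (hθ_nonneg : ∀ t, 0 ≤ t → 0 ≤ θ t)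
    (hθ_zero : θ 0 = 0)
    (hμ : TransportTau.TransportEntropyInequality (fun x y => θ (d x y)) μ) :
    TransportTau.PropertyTau μ (fun x y => 2 * θ (d x y / 2)) :=
  mainTheorem8_general d (fun x => (hd.eq_zero_iff x x).2 rfl) hd.symm hd.triangle hd_lsc.measurable
    μ θ hθ_convex hθ_nonneg hθ_zero hμ
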